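/- For elements $a,b$ of a C*-algebra $A$ write $a\ll b$ if $a=ab$. A net in $A$ is a family $(u_\lambda)_{\lambda\in\Lambda}$ indexed by a nonempty set $\Lambda$ with a transitive (not necessarily reflexive) relation $\prec$ such that any two elements of $\Lambda$ have a common upper bound: for all $\lambda,\mu$ there is $\nu$ with $\lambda\prec\nu$ and $\mu\prec\nu$. A net of positive elements of norm at most $1$ is an approximate unit of $A$ if $\|a-au_\lambda\|\to 0$ for every $a\in A$; it is $\ll$-increasing if $u_\lambda\ll u_\mu$ whenever $\lambda\prec\mu$. The C*-algebra $A$ is called $\ll$-unital if it has a $\ll$-increasing approximate unit. The density of a topological space is the minimum cardinality of a dense subset, and C*-subalgebras (norm closed $*$-subalgebras) need not contain the unit of the ambient algebra. A $Q$-set is a set $Y\subseteq\mathbb{R}$ such that every subset of $Y$ is a relative $G_\delta$ subset of $Y$. Let $\ell_2(\omega_1)$ and $\ell_2=\ell_2(\mathbb{N})$ be the complex Hilbert spaces of square summable functions on $\omega_1$ and on $\mathbb{N}$, and let $\mathcal{B}(H)$ be the C*-algebra of bounded linear operators on $H$. **Theorem 1.4.** 1. (In ZFC, without additional set-theoretic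 assumptions.) $\mathcal{B}(\ell_2(\omega_1))$ contains a C*-subalgebra of density $\omega_2$ which is not $\ll$-unital. 2. If there is an uncountable $Q$-set, then $\mathcal{B}(\ell_2)$ contains a C*-subalgebra of density $\omega_2$ which is not $\ll$-unital. -/

import Mathlib

open Cardinal

/-- The relation `a ≪ b` on an algebra: `a = a * b`. -/
def WayBelow {A : Type*} [Mul A] (a b : A) : Prop := a = a * b

/-- An element of a C*-algebra is positive if it has the form `star b * b`. -/
def IsPositiveElem {A : Type*} [NonUnitalCStarAlgebra A] (a : A) : Prop :=
  ∃ b : A, a = star b * b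

/-- `(Λ, r)` is a directed set: `Λ` is nonempty, `r` is transitive, and any two indices have a
common upper bound. The relation `r` is not required to be reflexive. -/
structure IsDirectedIndex {Λ : Type*} (r : Λ → Λ → Prop) : Prop where
  nonempty : Nonempty Λ
  trans : ∀ i j k, r i j → r j k → r i k
  directed : ∀ i j, ∃ k, r i k ∧ r j k

/-- The net `u`, indexed by the directed set `(Λ, r)`, is an approximate unit of `A`: it lies in
the positive part of the unit ball and `‖a - a * u i‖ → 0` along the net, for every `a`. -/
structure IsApproxUnitNet {A : Type*} [NonUnitalCStarAlgebra A] {Λ : Type*}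
    (r : Λ → Λ → Prop) (u : Λ → A) : Prop where
  index : IsDirectedIndex r
  pos : ∀ i, IsPositiveElem (u i)
  norm_le : ∀ i, ‖u i‖ ≤ 1
  tendsto : ∀ a : A, ∀ ε : ℝ, 0 < ε → ∃ i₀, ∀ i, r i₀ i → ‖a - a * u i‖ < ε

/-- The net `u` is `≪`-increasing. -/
def IsWayBelowIncreasing {A : Type*} [Mul A] {Λ : Type*} (r : Λ → Λ → Prop) (u : Λ → A) : Prop :=
  ∀ i j, r i j → WayBelow (u i) (u j)

/-- A C*-algebra is `≪`-unital if it has a `≪`-increasing approximate unit. Index sets are taken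
in the universe of `A`; by `isWayBelowUnital_of_net` below, index sets from any other universe
give the same notion. -/
def IsWayBelowUnital.{u} (A : Type u) [NonUnitalCStarAlgebra A] : Prop :=
  ∃ (Λ : Type u) (r : Λ → Λ → Prop) (u : Λ → A),
    IsApproxUnitNet r u ∧ IsWayBelowIncreasing r u

/-- A `≪`-increasing approximate unit indexed in an arbitrary universe makes `A` `≪`-unital. -/
theorem isWayBelowUnital_of_net {A : Type*} [NonUnitalCStarAlgebra A] {Λ : Type*}
    (r : Λ → Λ → Prop) (u : Λ → A) (hu : IsApproxUnitNet r u) (hi : IsWayBelowIncreasing r u) :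
    IsWayBelowUnital A := by
  refine ⟨Set.range u, fun a b => WayBelow a.1 b.1, fun a => a.1, ⟨⟨?_, ?_, ?_⟩, ?_, ?_, ?_⟩, ?_⟩
  · obtain ⟨i⟩ := hu.index.nonempty
    exact ⟨⟨u i, i, rfl⟩⟩
  · rintro ⟨a, ha⟩ ⟨b, hb⟩ ⟨c, hc⟩ hab hbc
    simp only [WayBelow] at hab hbc ⊢
    calc a = a * b := hab
      _ = a * (b * c) := by rw [← hbc]
      _ = a * c := by rw [← mul_assoc, ← hab]
  · rintro ⟨-, i, rfl⟩ ⟨-, j, rfl⟩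
    obtain ⟨k, hik, hjk⟩ := hu.index.directed i j
    exact ⟨⟨u k, k, rfl⟩, hi _ _ hik, hi _ _ hjk⟩
  · rintro ⟨-, i, rfl⟩
    exact hu.pos i
  · rintro ⟨-, i, rfl⟩
    exact hu.norm_le i
  · intro a ε hε
    obtain ⟨i₀, h₀⟩ := hu.tendsto a (ε / 2) (by positivity)
    obtain ⟨i₁, h₁, -⟩ := hu.index.directed i₀ i₀
    refine ⟨⟨u i₁, i₁, rfl⟩, ?_⟩
    rintro ⟨-, j, rfl⟩ hj
    simp only [WayBelow] at hj
    have key : a - a * u j = (a - a * u i₁) - (a - a * u i₁) * u j := by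
      rw [sub_mul, mul_assoc, ← hj]; abel
    have h2 : ‖(a - a * u i₁) * u j‖ ≤ ‖a - a * u i₁‖ :=
      (norm_mul_le _ _).trans (mul_le_of_le_one_right (norm_nonneg _) (hu.norm_le j))
    have h3 := norm_sub_le (a - a * u i₁) ((a - a * u i₁) * u j)
    have h4 := h₀ i₁ h₁
    rw [key]
    linarith
  · rintro a b hab
    exact hab

/-- The density of a topological space: the minimum cardinality of a dense subset. -/
noncomputable def topDensity.{u} (X : Type u) [TopologicalSpace X] : Cardinal.{u} :=
  sInf {κ | ∃ s : Set X, Dense s ∧ #s = κ}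

/-- The Hilbert space `ℓ₂(ι)` of square summable complex functions on `ι`. -/
abbrev EllTwo.{u} (ι : Type u) : Type u := lp (fun _ : ι => ℂ) 2

/-- A set of reals is a `Q`-set if each of its subsets is a relative `G_δ` set in it. -/
def IsQSet (Y : Set ℝ) : Prop := ∀ Z ⊆ Y, ∃ G : Set ℝ, IsGδ G ∧ Z = Y ∩ G

/-- `𝓑(H)` contains a C*-subalgebra (a norm closed, not necessarily unital, `*`-subalgebra) of
density `κ` which is not `≪`-unital. -/
def HasNonWayBelowUnitalSubalgebra.{u} (H : Type u) [NormedAddCommGroup H] [InnerProductSpace ℂ H]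
    [CompleteSpace H] (κ : Cardinal.{u}) : Prop :=
  ∃ (A : NonUnitalStarSubalgebra ℂ (H →L[ℂ] H)) (_ : IsClosed (A : Set (H →L[ℂ] H))),
    topDensity A = κ ∧ ¬ IsWayBelowUnital A

/-!
Two projections `P` and `Q` may lie in a C*-algebra `C` in which they have no common `≪`-upper
bound. Here they act on a direct sum of planes: in the `n`-th plane, `P` projects onto the first
axis and `Q` onto the line of slope `1 / (n + 1)`. A common `≪`-upper bound has to be the identity,
but every element of the C*-algebra generated by `P` and `Q` tends to zero on the second axes.

Such algebras still have `≪`-increasing approximate units, which consist of perturbations of `P` and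
`Q`. To rule out perturbations, take a family `χ i` (`i < ω₂`) of partial colourings of a set of
size `ℵ₁` by `P` and `Q` whose supports are uncountable and almost disjoint, that is, have countable
intersections, and let `p i` be the field of projections given by `χ i`. Since the supports are
almost disjoint, every element `a` of the C*-algebra `A` generated by the `p i` agrees on the
support of `χ i`, up to a countable set, with a scalar multiple `t • p i`, and `t` is multiplicative
in `a`. If `u ≪ v` in a `≪`-increasing approximate unit, and `u` is so large that its coefficient
at `i` is not zero, then the coefficient of `v` is `1`: off a countable set, `v` is *equal* to `p i`
on the support of `χ i` (`coeff_ne_zero_of_norm_lt`, `coeff_eq_one_of_eq_mul`). If two such elements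
`v`, for `i` and for `j`, are equal to `P` and to `Q` at the same point, then they have no common
upper bound in `A` (`false_of_common_upper_bound`).

So the family has to be such that, whichever countable sets are removed, some `χ i` and `χ j`
conflict at a remaining point. Such families are built in ZFC by a diagonalization due to Luzin
(`exists_isLuzinFamily`), where `χ i` conflicts, off any countable set, with all but countably many
of its predecessors; `ω₂` is what lets one point have uncountably many predecessors for which the
same countable set is removed.

The algebra acts on `ℓ₂(ω₁)` because there are `ℵ₁` many points. With a `Q`-set of size `ℵ₁`, the
points can be replaced by the branches that they determine in a countable tree of intervals: each
partial colouring of the `Q`-set is the limit along the branches of a partial colouring of the tree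
(`IsQSet.liftsColorings`), and the argument goes through with limits along the branches in place of
values at points. Both cases are treated together, with a filter `F ξ` for each point `ξ`.
-/

/-! ### Luzin families of partial two-colourings -/

/-- The domain of a partial two-colouring `χ`. -/
def colorSupport {Ω : Type*} (χ : Ω → Option Bool) : Set Ω := {ξ | χ ξ ≠ none}

/-- Two partial colourings conflict outside `B` if some point off `B` gets both colours. -/
def ConflictOff {Ω : Type*} (B : Set Ω) (χ ψ : Ω → Option Bool) : Prop :=
  ∃ ξ ∉ B, ∃ c, χ ξ = some c ∧ ψ ξ = some (!c)

/-- `D` extends the family `C` in the sense of Luzin: `D` has uncountable support, almost disjoint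
from the support of each member of `C`, and yet, off any countable set, it conflicts with all but
countably many members of `C`. -/
structure IsLuzinExtension {Ω J : Type*} (C : J → Ω → Option Bool) (D : Ω → Option Bool) :
    Prop where
  uncountable : ¬ (colorSupport D).Countable
  almostDisjoint : ∀ j, (colorSupport D ∩ colorSupport (C j)).Countable
  conflict : ∀ B : Set Ω, B.Countable → {j | ¬ ConflictOff B D (C j)}.Countable

/-- Luzin's diagonalization: a point `x j` of the support of `C j`, outside the supports of
the countably many members enumerated earlier, is given the colour that `C j` does not use. -/
theorem exists_isLuzinExtension {Ω J W : Type*} [LinearOrder W]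
    (hW : ∀ w : W, (Set.Iic w).Countable) {e : J → W} (he : e.Injective) (hJ : Uncountable J)
    {C : J → Ω → Option Bool} (hC : ∀ j, ¬ (colorSupport (C j)).Countable)
    (hCC : Pairwise fun i j => (colorSupport (C i) ∩ colorSupport (C j)).Countable) :
    ∃ D, IsLuzinExtension C D := by
  have hcount (w : W) : {j | e j ≤ w}.Countable := (hW w).preimage he
  have hx (j : J) : ∃ x ∈ colorSupport (C j), ∀ i, e i < e j → x ∉ colorSupport (C i) := by
    by_contra! h
    refine hC j (((hcount (e j)).mono (s₁ := {i | e i < e j}) fun i hi => le_of_lt hi).biUnion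
      (t := fun i _ => colorSupport (C i) ∩ colorSupport (C j))
      (fun i hi => hCC (by rintro rfl; exact lt_irrefl _ hi)) |>.mono ?_)
    intro x hx
    obtain ⟨i, hi, hxi⟩ := h x hx
    exact Set.mem_biUnion (show i ∈ {i | e i < e j} from hi) ⟨hxi, hx⟩
  choose x hxs hxn using hx
  have xinj : x.Injective := by
    intro i j hij
    rcases lt_trichotomy (e i) (e j) with h | h | h
    · exact absurd (hij ▸ hxs i) (hxn j i h)
    · exact he h
    · exact absurd (hij ▸ hxs j) (hxn i j h)
  classical
  let D : Ω → Option Bool := fun ξ =>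
    if h : ∃ j, x j = ξ then (C h.choose ξ).map not else none
  have hD (j : J) : D (x j) = (C j (x j)).map not := by
    have h : ∃ i, x i = x j := ⟨j, rfl⟩
    simp only [D, dif_pos h, xinj h.choose_spec]
  have hD' (ξ : Ω) (h : ξ ∈ colorSupport D) : ∃ j, x j = ξ := by
    by_contra hn
    exact h (by simp only [D, dif_neg hn])
  refine ⟨D, ?_, fun j => ?_, fun B hB => ?_⟩
  · intro h
    refine not_countable (α := J) ((Set.countable_univ_iff).1 ((h.preimage xinj).mono ?_))
    intro j _
    have := hxs j
    simp only [Set.mem_preimage, colorSupport, Set.mem_ofPred_eq, hD] at this ⊢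
    simpa using this
  · refine ((hcount (e j)).image x).mono ?_
    rintro ξ ⟨h1, h2⟩
    obtain ⟨i, rfl⟩ := hD' ξ h1
    exact ⟨i, not_lt.1 fun h => hxn i j h h2, rfl⟩
  · refine (hB.preimage xinj).mono fun j hj => ?_
    by_contra hjB
    refine hj ⟨x j, hjB, ?_⟩
    obtain ⟨c, hc⟩ := Option.ne_none_iff_exists'.1 (hxs j)
    exact ⟨!c, by simp [hD, hc], by simp [hc]⟩

/-- A sequence, indexed by a well-order whose initial segments have at most `ℵ₁` elements, each term
of which is a Luzin extension of the family of the earlier ones. -/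
theorem exists_luzin_sequence {Ω I : Type*} [LinearOrder Ω] (hΩ : ∀ ω : Ω, (Set.Iic ω).Countable)
    [Uncountable Ω] (f : Ω × Ω ≃ Ω) (g : Ω ⊕ Ω ≃ Ω) [LinearOrder I] [WellFoundedLT I]
    (hI : ∀ i : I, ∃ e : Set.Iio i → Ω, e.Injective) :
    ∃ χ : I → Ω → Option Bool, ∀ i, IsLuzinExtension (fun j : Set.Iio i => χ j) (χ i) := by
  classical
  -- Disjoint uncountable sets put below every initial segment make all index sets uncountable.
  let G : Ω → Ω → Option Bool := fun ω ξ => if (f.symm ξ).1 = ω then some true else none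
  have hG (ω : Ω) : colorSupport (G ω) = Set.range fun η => f (ω, η) := by
    ext ξ
    obtain ⟨⟨a, b⟩, rfl⟩ := f.surjective ξ
    simp [colorSupport, G, eq_comm]
  have hGu (ω : Ω) : ¬ (colorSupport (G ω)).Countable := by
    rw [hG]
    intro h
    have hinj : Function.Injective fun η => f (ω, η) := fun a b hab => by simpa using hab
    have huniv := h.preimage hinj
    rw [Set.preimage_range] at huniv
    exact not_countable (α := Ω) (Set.countable_univ_iff.1 huniv)
  let fam (i : I) (prev : (j : I) → j < i → Ω → Option Bool) : Ω ⊕ Set.Iio i → Ω → Option Bool :=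
    Sum.elim G fun j => prev j.1 j.2
  let step (i : I) (prev : (j : I) → j < i → Ω → Option Bool) : Ω → Option Bool :=
    if h : ∃ D, IsLuzinExtension (fam i prev) D then h.choose else fun _ => none
  let χ : I → Ω → Option Bool := (wellFounded_lt (α := I)).fix step
  have hχ (i : I) : χ i = step i fun j _ => χ j := (wellFounded_lt (α := I)).fix_eq step i
  have key (i : I) : IsLuzinExtension (fam i fun j _ => χ j) (χ i) := by
    induction i using WellFoundedLT.induction with
    | ind i ih =>
    suffices h : ∃ D, IsLuzinExtension (fam i fun j _ => χ j) D by
      rw [hχ]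
      simpa only [step, dif_pos h] using h.choose_spec
    obtain ⟨e, he⟩ := hI i
    refine exists_isLuzinExtension hΩ
      (e := fun s => g (Sum.map id e s)) (g.injective.comp (Sum.map_injective.2
        ⟨Function.injective_id, he⟩)) ?_ ?_ ?_
    · exact (Sum.inl_injective (α := Ω) (β := Set.Iio i)).uncountable
    · rintro (ω | j)
      · exact hGu ω
      · exact (ih j.1 j.2).uncountable
    · rintro (ω | j) (ω' | j') hne
      · convert Set.countable_empty
        ext ξ
        simp only [fam, Sum.elim_inl, hG, Set.mem_inter_iff, Set.mem_range, Set.mem_empty_iff_false,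
          iff_false, not_and]
        rintro ⟨a, rfl⟩ ⟨b, hb⟩
        simp only [EmbeddingLike.apply_eq_iff_eq, Prod.mk.injEq] at hb
        exact hne (by rw [hb.1])
      · rw [Set.inter_comm]
        exact (ih j'.1 j'.2).almostDisjoint (Sum.inl ω)
      · exact (ih j.1 j.2).almostDisjoint (Sum.inl ω')
      · rcases lt_trichotomy j j' with h | h | h
        · rw [Set.inter_comm]
          exact (ih j'.1 j'.2).almostDisjoint (Sum.inr ⟨j.1, h⟩)
        · exact absurd (by rw [h]) hne
        · exact (ih j.1 j.2).almostDisjoint (Sum.inr ⟨j'.1, h⟩)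
  exact ⟨χ, fun i => ⟨(key i).uncountable, fun j => (key i).almostDisjoint (Sum.inr j),
    fun B hB => ((key i).conflict B hB).preimage Sum.inr_injective⟩⟩

theorem mk_iUnion_le_aleph_one.{u} {α ι : Type u} (f : ι → Set α) (hι : #ι ≤ ℵ₁)
    (hf : ∀ i, #(f i) ≤ ℵ₁) : #(⋃ i, f i) ≤ ℵ₁ :=
  (mk_iUnion_le f).trans ((mul_le_mul' hι (ciSup_le' hf)).trans
    (mul_eq_self (aleph0_le_aleph 1)).le)

/-- In a well-order of type `ω₂`, some fibre of any map to a set of size `ℵ₁` has a point with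
uncountably many predecessors in the fibre: a fibre of size `ℵ₂` contains a bound of `ℵ₁` many of
its points. -/
theorem exists_uncountable_fiber_Iio.{u} {Ω I : Type u} [LinearOrder I] (hΩ : #Ω = ℵ₁)
    (hI : #I = ℵ_ 2) (hlt : ∀ i : I, #(Set.Iio i) ≤ ℵ₁) (c : I → Ω) :
    ∃ i, ¬ {j | j < i ∧ c j = c i}.Countable := by
  have h12 : ℵ₁ < ℵ_ 2 := aleph_lt_aleph.2 (by norm_num)
  obtain ⟨ω, hω⟩ : ∃ ω, ℵ₁ < #(c ⁻¹' {ω}) := by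
    by_contra! h
    refine h12.not_ge ?_
    rw [← hI, ← mk_univ, ← Set.iUnion_of_singleton_coe Set.univ]
    refine le_trans (mk_le_mk_of_subset ?_) (mk_iUnion_le_aleph_one _ hΩ.le h)
    intro i _
    exact Set.mem_iUnion.2 ⟨c i, rfl⟩
  obtain ⟨p, hp, hpc⟩ := le_mk_iff_exists_subset.1 hω.le
  have hIic (i : I) : #(Set.Iic i) ≤ ℵ₁ := by
    rw [← Set.Iio_insert]
    exact mk_insert_le.trans ((add_le_add_left (hlt i) 1).trans
      (add_one_eq (aleph0_le_aleph 1)).le)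
  obtain ⟨i, hi, hip⟩ : ∃ i ∈ c ⁻¹' {ω}, i ∉ ⋃ x : p, Set.Iic x.1 := by
    by_contra! h
    exact hω.not_ge ((mk_le_mk_of_subset h).trans
      (mk_iUnion_le_aleph_one _ hpc.le fun x => hIic x))
  refine ⟨i, fun hc => ?_⟩
  have hpcount : p.Countable := hc.mono fun x hx => by
    refine ⟨lt_of_not_ge fun h => hip (Set.mem_iUnion.2 ⟨⟨x, hx⟩, h⟩), ?_⟩
    exact (hp hx).trans (Eq.symm hi)
  exact aleph0_lt_aleph_one.not_ge (hpc ▸ le_aleph0_iff_set_countable.2 hpcount)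

/-- A Luzin family: partial two-colourings with uncountable, almost disjoint supports, which cannot
be made compatible by restricting each of them to a cocountable set. -/
structure IsLuzinFamily {Ω I : Type*} (χ : I → Ω → Option Bool) : Prop where
  uncountable : ∀ i, ¬ (colorSupport (χ i)).Countable
  almostDisjoint : Pairwise fun i j => (colorSupport (χ i) ∩ colorSupport (χ j)).Countable
  conflict : ∀ B : I → Set Ω, (∀ i, (B i).Countable) →
    ∃ i j, ConflictOff (B i ∪ B j) (χ i) (χ j)

/-- A set of size `c` has a well-order whose proper initial segments are smaller than `c`. -/
theorem exists_linearOrder_mk_Iio_lt.{u} (α : Type u) :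
    ∃ (_ : LinearOrder α) (_ : WellFoundedLT α), ∀ a : α, #(Set.Iio a) < #α := by
  obtain ⟨lo, wo, h⟩ := exists_ord_eq_type_lt α
  exact ⟨lo, wo, fun a => mk_Iio_lt a h⟩

/-- There is a Luzin family of `ℵ₂` many partial two-colourings of a set of size `ℵ₁`. -/
theorem exists_isLuzinFamily.{u} {Ω I : Type u} (hΩ : #Ω = ℵ₁) (hI : #I = ℵ_ 2) :
    ∃ χ : I → Ω → Option Bool, IsLuzinFamily χ := by
  obtain ⟨_, _, hΩlt⟩ := exists_linearOrder_mk_Iio_lt Ω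
  obtain ⟨_, _, hIlt⟩ := exists_linearOrder_mk_Iio_lt I
  have hΩinf : ℵ₀ ≤ #Ω := hΩ ▸ aleph0_le_aleph 1
  have hIic (ω : Ω) : (Set.Iic ω).Countable := by
    rw [← Set.Iio_insert]
    exact (le_aleph0_iff_set_countable.1 (lt_aleph_one_iff.1 (hΩ ▸ hΩlt ω))).insert _
  have : Uncountable Ω := aleph0_lt_mk_iff.1 (hΩ ▸ aleph0_lt_aleph_one)
  have hlt (i : I) : #(Set.Iio i) ≤ ℵ₁ := by
    have h2 : (ℵ_ 2 : Cardinal.{u}) = Order.succ ℵ₁ := by rw [succ_aleph]; norm_num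
    exact Order.lt_succ_iff.1 (h2 ▸ hI ▸ hIlt i)
  obtain ⟨f⟩ : Nonempty (Ω × Ω ≃ Ω) := Cardinal.eq.1 (by simp [mul_eq_self hΩinf])
  obtain ⟨g⟩ : Nonempty (Ω ⊕ Ω ≃ Ω) := Cardinal.eq.1 (by simp [add_eq_self hΩinf])
  obtain ⟨χ, hχ⟩ := exists_luzin_sequence hIic f g (I := I) fun i => by
    obtain ⟨e⟩ := (hlt i).trans hΩ.ge
    exact ⟨e, e.injective⟩
  refine ⟨χ, fun i => (hχ i).uncountable, fun i j hij => ?_, fun B hB => ?_⟩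
  · rcases lt_or_gt_of_ne hij with h | h
    · rw [Set.inter_comm]
      exact (hχ j).almostDisjoint ⟨i, h⟩
    · exact (hχ i).almostDisjoint ⟨j, h⟩
  · have hbd (i : I) : ∃ ω, B i ⊆ Set.Iic ω := by
      have : ((⋃ ω ∈ B i, Set.Iic ω)ᶜ : Set Ω).Nonempty := by
        rw [Set.nonempty_compl]
        intro h
        exact not_countable (α := Ω) (Set.countable_univ_iff.1
          (h ▸ (hB i).biUnion fun ω _ => hIic ω))
      obtain ⟨ω, hω⟩ := this
      refine ⟨ω, fun η hη => le_of_not_ge fun h => hω ?_⟩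
      exact Set.mem_biUnion hη h
    choose c hc using hbd
    obtain ⟨i, hi⟩ := exists_uncountable_fiber_Iio hΩ hI hlt c
    obtain ⟨j, ⟨hji, hcj⟩, hj⟩ : ∃ j, (j < i ∧ c j = c i) ∧
        ∃ h : j < i, ConflictOff (Set.Iic (c i)) (χ i) (χ (⟨j, h⟩ : Set.Iio i)) := by
      by_contra! h
      refine hi ((((hχ i).conflict _ (hIic (c i))).image Subtype.val).mono fun j hj => ?_)
      exact ⟨⟨j, hj.1⟩, h j hj hj.1, rfl⟩
    obtain ⟨_, ξ, hξ, hcol⟩ := hj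
    refine ⟨i, j, ξ, ?_, hcol⟩
    rintro (h | h)
    · exact hξ (hc i h)
    · exact hξ (hcj ▸ hc j h)

/-! ### Lifting colourings, and `Q`-sets -/

/-- The partial two-colouring `χ'` of `X` is a lift of the partial two-colouring `χ` of `Ω`: it is
eventually equal to `χ ξ` along the filter `F ξ`, for every `ξ`. -/
def IsColoringLift {Ω X : Type*} (F : Ω → Filter X) (χ : Ω → Option Bool) (χ' : X → Option Bool) :
    Prop := ∀ ξ, ∀ᶠ x in F ξ, χ' x = χ ξ

/-- Every partial two-colouring of `Ω` lifts to `X` along the filters `F ξ`. -/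
def LiftsColorings {Ω X : Type*} (F : Ω → Filter X) : Prop :=
  ∀ χ : Ω → Option Bool, ∃ χ' : X → Option Bool, IsColoringLift F χ χ'

/-- Lifting subsets is enough for lifting partial two-colourings. -/
theorem liftsColorings_of_sets {Ω X : Type*} {F : Ω → Filter X}
    (h : ∀ Z : Set Ω, ∃ S : Set X, ∀ ξ, ∀ᶠ x in F ξ, x ∈ S ↔ ξ ∈ Z) : LiftsColorings F := by
  classical
  intro χ
  obtain ⟨S, hS⟩ := h {ξ | χ ξ = some true}
  obtain ⟨T, hT⟩ := h {ξ | χ ξ = some false}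
  refine ⟨fun x => if x ∈ S then some true else if x ∈ T then some false else none, fun ξ => ?_⟩
  filter_upwards [hS ξ, hT ξ] with x h1 h2
  rcases hc : χ ξ with _ | _ | _ <;> simp_all

theorem IsQSet.mono {Y Y' : Set ℝ} (hY : IsQSet Y) (h : Y' ⊆ Y) : IsQSet Y' := by
  intro Z hZ
  obtain ⟨G, hG, rfl⟩ := hY Z (hZ.trans h)
  refine ⟨G, hG, ?_⟩
  ext x
  exact ⟨fun hx => ⟨hZ hx, hx.2⟩, fun hx => ⟨h hx.1, hx.2⟩⟩

/-- Subsets of a `Q`-set are relative `F_σ` sets. -/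
theorem IsQSet.exists_closed {Y : Set ℝ} (hY : IsQSet Y) {Z : Set ℝ} (hZ : Z ⊆ Y) :
    ∃ K : ℕ → Set ℝ, (∀ n, IsClosed (K n)) ∧ Monotone K ∧ Z = Y ∩ ⋃ n, K n := by
  obtain ⟨G, hG, hGZ⟩ := hY (Y \ Z) Set.sdiff_subset
  obtain ⟨U, hU, rfl⟩ := hG.eq_iInter_nat
  refine ⟨Set.accumulate fun n => (U n)ᶜ, fun n => ?_, Set.monotone_accumulate, ?_⟩
  · exact (Set.finite_Iic n).isClosed_biUnion fun i _ => (hU i).isClosed_compl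
  · rw [Set.iUnion_accumulate, ← Set.compl_iInter]
    ext x
    have := Set.ext_iff.1 hGZ x
    simp only [Set.mem_sdiff, Set.mem_inter_iff, Set.mem_compl_iff] at this ⊢
    constructor
    · exact fun hx => ⟨hZ hx, fun h => (this.2 ⟨hZ hx, h⟩).2 hx⟩
    · rintro ⟨h1, h2⟩
      by_contra hx
      exact h2 (this.1 ⟨h1, hx⟩).2

/-- The code `(n, k)` of the dyadic interval `[k / 2 ^ n, (k + 1) / 2 ^ n)` that contains `y`. -/
noncomputable def dyadicCode (y : ℝ) (n : ℕ) : ℕ × ℤ := (n, ⌊2 ^ n * y⌋)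

/-- The dyadic intervals around `y` shrink to `y`, so that they miss a closed set off `y`. -/
theorem eventually_dyadicCode_disjoint {K : Set ℝ} (hK : IsClosed K) {y : ℝ} (hy : y ∉ K) :
    ∀ᶠ n in Filter.atTop, ∀ z ∈ K, dyadicCode z n ≠ dyadicCode y n := by
  obtain ⟨ε, hε, hball⟩ := Metric.isOpen_iff.1 hK.isOpen_compl y hy
  obtain ⟨N, hN⟩ := exists_pow_lt_of_lt_one hε (by norm_num : (1 / 2 : ℝ) < 1)
  filter_upwards [Filter.eventually_ge_atTop N] with n hn z hz heq
  refine hball (?_ : z ∈ Metric.ball y ε) hz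
  simp only [dyadicCode, Prod.mk.injEq, true_and] at heq
  have h := Int.abs_sub_lt_one_of_floor_eq_floor heq
  rw [← mul_sub, abs_mul, abs_of_pos (by positivity)] at h
  have h2 : (1 / 2 : ℝ) ^ n ≤ (1 / 2) ^ N := pow_le_pow_of_le_one (by norm_num) (by norm_num) hn
  have h3 : |z - y| < (1 / 2) ^ n := by
    rw [one_div, inv_pow, ← one_div, lt_div_iff₀ (by positivity), mul_comm]
    exact h
  rw [Metric.mem_ball, Real.dist_eq]
  linarith

/-- The branches of dyadic intervals through the points of a `Q`-set form an almost disjoint family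
each part of which can be separated from the rest. -/
theorem IsQSet.liftsColorings {Y : Set ℝ} (hY : IsQSet Y) :
    LiftsColorings fun y : Y => Filter.map (dyadicCode y) Filter.atTop := by
  refine liftsColorings_of_sets fun Z => ?_
  have hsub (W : Set Y) : (Subtype.val '' W) ⊆ Y := by
    rintro _ ⟨y, _, rfl⟩
    exact y.2
  obtain ⟨K, hKc, hKm, hK⟩ := hY.exists_closed (hsub Z)
  obtain ⟨L, hLc, hLm, hL⟩ := hY.exists_closed (hsub Zᶜ)
  have hK' (y : Y) : y ∈ Z ↔ ∃ n, (y : ℝ) ∈ K n := by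
    have := Set.ext_iff.1 hK y
    simpa using this
  have hL' (y : Y) : y ∉ Z ↔ ∃ n, (y : ℝ) ∈ L n := by
    have := Set.ext_iff.1 hL y
    simpa using this
  refine ⟨{x | ∃ m, (∃ z ∈ K m, dyadicCode z x.1 = x) ∧ ∀ z ∈ L m, dyadicCode z x.1 ≠ x},
    fun y => ?_⟩
  rw [Filter.eventually_map]
  by_cases hyZ : y ∈ Z
  · obtain ⟨m, hm⟩ := (hK' y).1 hyZ
    have hn : (y : ℝ) ∉ L m := fun h => (hL' y).2 ⟨m, h⟩ hyZ
    filter_upwards [eventually_dyadicCode_disjoint (hLc m) hn] with n hn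
    exact iff_of_true ⟨m, ⟨y, hm, rfl⟩, hn⟩ hyZ
  · obtain ⟨m, hm⟩ := (hL' y).1 hyZ
    have hn : (y : ℝ) ∉ K m := fun h => hyZ ((hK' y).2 ⟨m, h⟩)
    filter_upwards [eventually_dyadicCode_disjoint (hKc m) hn] with n hn
    refine iff_of_false ?_ hyZ
    rintro ⟨k, ⟨z, hzk, hz⟩, hk⟩
    rcases le_total k m with hkm | hmk
    · exact hn z (hKm hkm hzk) hz
    · exact hk y (hLm hmk hm) rfl

/-! ### Projections attached to partial two-colourings -/

section Projections

variable {H : Type*} [NormedAddCommGroup H] [InnerProductSpace ℂ H]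
  {X : Type*} (b : X × ℕ × Bool → H)

/-- The slopes `1 / (n + 1)` of the lines onto which the colour `true` projects. -/
noncomputable def lineSlope (n : ℕ) : ℝ := 1 / ((n : ℝ) + 1)

theorem lineSlope_pos (n : ℕ) : 0 < lineSlope n := by unfold lineSlope; positivity

theorem tendsto_lineSlope : Filter.Tendsto lineSlope Filter.atTop (nhds 0) :=
  tendsto_one_div_add_atTop_nhds_zero_nat

/-- The vectors to which the range of `colorProj b χ` is orthogonal. -/
def colorNormals (χ : X → Option Bool) : Set H :=
  {v | ∃ x n, (χ x = none ∧ v = b (x, n, false)) ∨ (χ x ≠ some true ∧ v = b (x, n, true)) ∨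
    (χ x = some true ∧ v = b (x, n, true) - (lineSlope n : ℂ) • b (x, n, false))}

variable [CompleteSpace H]

/-- The projection attached to the partial two-colouring `χ` of `X` and the orthonormal family `b`.
It acts on the planes spanned by `b (x, n, false)` and `b (x, n, true)`: it is zero there if `χ x`
is undefined, the projection onto the first axis if `χ x = false`, and the projection onto the line
of slope `1 / (n + 1)` if `χ x = true`. On the complement of these planes it is the identity. -/
noncomputable def colorProj (χ : X → Option Bool) : H →L[ℂ] H :=
  (Submodule.span ℂ (colorNormals b χ))ᗮ.starProjection

theorem star_colorProj (χ : X → Option Bool) : star (colorProj b χ) = colorProj b χ :=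
  isSelfAdjoint_starProjection _

theorem colorProj_mul_self (χ : X → Option Bool) : colorProj b χ * colorProj b χ = colorProj b χ :=
  Submodule.isIdempotentElem_starProjection _

variable {b}

/-- The value of `colorProj b χ` at a vector, from an orthogonal decomposition of that vector. -/
theorem colorProj_apply_eq {χ : X → Option Bool} {v w : H}
    (hw : ∀ z ∈ colorNormals b χ, inner ℂ z w = 0)
    (hvw : v - w ∈ Submodule.span ℂ (colorNormals b χ)) : colorProj b χ v = w := by
  refine Submodule.eq_starProjection_of_mem_orthogonal ?_
    (Submodule.le_orthogonal_orthogonal _ hvw)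
  rw [Submodule.mem_orthogonal]
  intro z hz
  induction hz using Submodule.span_induction with
  | mem z hz => exact hw z hz
  | zero => simp
  | add y z _ _ hy hz => simp [inner_add_left, hy, hz]
  | smul c z _ hz => simp [inner_smul_left, hz]

theorem colorProj_of_none {χ : X → Option Bool} {x : X} (hx : χ x = none) (n : ℕ) (i : Bool) :
    colorProj b χ (b (x, n, i)) = 0 := by
  refine colorProj_apply_eq (by simp) (Submodule.subset_span ?_)
  rw [sub_zero]
  cases i
  · exact ⟨x, n, Or.inl ⟨hx, rfl⟩⟩
  · exact ⟨x, n, Or.inr (Or.inl ⟨by simp [hx], rfl⟩)⟩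

theorem colorProj_of_false_true {χ : X → Option Bool} {x : X} (hx : χ x = some false) (n : ℕ) :
    colorProj b χ (b (x, n, true)) = 0 := by
  refine colorProj_apply_eq (by simp) (Submodule.subset_span ?_)
  rw [sub_zero]
  exact ⟨x, n, Or.inr (Or.inl ⟨by simp [hx], rfl⟩)⟩

theorem colorProj_of_false_false (hb : Orthonormal ℂ b) {χ : X → Option Bool} {x : X}
    (hx : χ x = some false) (n : ℕ) :
    colorProj b χ (b (x, n, false)) = b (x, n, false) := by
  classical
  refine colorProj_apply_eq ?_ (by simp)
  rw [orthonormal_iff_ite] at hb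
  rintro z ⟨y, m, ⟨hy, rfl⟩ | ⟨hy, rfl⟩ | ⟨hy, rfl⟩⟩
  · rw [hb, if_neg]
    simp only [Prod.mk.injEq, not_and]
    rintro rfl
    simp [hx] at hy
  · simp [hb]
  · rw [inner_sub_left, inner_smul_left, hb, hb, if_neg, if_neg]
    · simp
    · simp only [Prod.mk.injEq, not_and]
      rintro rfl
      simp [hx] at hy
    · simp

theorem colorProj_of_true (hb : Orthonormal ℂ b) {χ : X → Option Bool} {x : X}
    (hx : χ x = some true) (n : ℕ) (i : Bool) :
    colorProj b χ (b (x, n, i)) =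
      ((1 + (lineSlope n : ℂ) ^ 2)⁻¹ * (if i then (lineSlope n : ℂ) else 1)) •
      (b (x, n, false) + (lineSlope n : ℂ) • b (x, n, true)) := by
  classical
  have hne : (1 + (lineSlope n : ℂ) ^ 2) ≠ 0 := by
    have : (0 : ℝ) < 1 + lineSlope n ^ 2 := by positivity
    exact_mod_cast this.ne'
  refine colorProj_apply_eq ?_ ?_
  · have hnorm := hb.1
    rw [orthonormal_iff_ite] at hb
    intro z hz
    rw [inner_smul_right]
    refine mul_eq_zero_of_right _ ?_
    obtain ⟨y, m, ⟨hy, rfl⟩ | ⟨hy, rfl⟩ | ⟨hy, rfl⟩⟩ := hz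
    · have hyx : y ≠ x := by rintro rfl; simp [hx] at hy
      simp [inner_add_right, inner_smul_right, hb, hyx, -Complex.coe_smul]
    · have hyx : y ≠ x := by rintro rfl; simp [hx] at hy
      simp [inner_add_right, inner_smul_right, hb, hyx, -Complex.coe_smul]
    · by_cases hyx : y = x ∧ m = n
      · obtain ⟨rfl, rfl⟩ := hyx
        simp [inner_add_right, inner_smul_right, inner_sub_left, inner_smul_left, hb,
          hnorm, -Complex.coe_smul]
      · have hyx' : ∀ i j, ((y, m, i) : X × ℕ × Bool) ≠ (x, n, j) := by
          intro i j h
          simp only [Prod.mk.injEq] at h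
          exact hyx ⟨h.1, h.2.1⟩
        simp [inner_add_right, inner_smul_right, inner_sub_left, inner_smul_left, hb, hyx',
          -Prod.mk.injEq, -Complex.coe_smul]
  · have hmem : b (x, n, true) - (lineSlope n : ℂ) • b (x, n, false) ∈
        Submodule.span ℂ (colorNormals b χ) :=
      Submodule.subset_span ⟨x, n, Or.inr (Or.inr ⟨hx, rfl⟩)⟩
    cases i
    · convert Submodule.smul_mem _ (-(lineSlope n : ℂ) * (1 + (lineSlope n : ℂ) ^ 2)⁻¹) hmem using 1
      simp only [Bool.false_eq_true, if_false]
      match_scalars <;> field_simp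
      ring
    · convert Submodule.smul_mem _ ((1 + (lineSlope n : ℂ) ^ 2)⁻¹) hmem using 1
      simp only [if_true]
      match_scalars <;> field_simp
      ring

theorem half_le_norm_colorProj (hb : Orthonormal ℂ b) {χ : X → Option Bool} {x : X}
    (hx : χ x ≠ none) : 1 / 2 ≤ ‖colorProj b χ (b (x, 0, false))‖ := by
  classical
  rcases h : χ x with _ | _ | _
  · exact absurd h hx
  · rw [colorProj_of_false_false hb h, hb.1]
    norm_num
  · have hin : inner ℂ (b (x, 0, false)) (colorProj b χ (b (x, 0, false))) = 1 / 2 := by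
      rw [colorProj_of_true hb h]
      have hnorm := hb.1
      rw [orthonormal_iff_ite] at hb
      simp [hb, hnorm, lineSlope]
      norm_num
    have h1 := norm_inner_le_norm (𝕜 := ℂ) (b (x, 0, false)) (colorProj b χ (b (x, 0, false)))
    rw [hin, hb.1, one_mul] at h1
    simpa using h1

theorem norm_colorProj_true_le (hb : Orthonormal ℂ b) (χ : X → Option Bool) (x : X) (n : ℕ) :
    ‖colorProj b χ (b (x, n, true))‖ ≤ 2 * lineSlope n := by
  have hs := lineSlope_pos n
  have hs1 : lineSlope n ≤ 1 := by
    unfold lineSlope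
    rw [div_le_one (by positivity)]
    linarith [(Nat.cast_nonneg n : (0 : ℝ) ≤ n)]
  rcases h : χ x with _ | _ | _
  · rw [colorProj_of_none h, norm_zero]; positivity
  · rw [colorProj_of_false_true h, norm_zero]; positivity
  · rw [colorProj_of_true hb h, if_pos rfl, norm_smul, norm_mul, norm_inv, mul_comm 2]
    have h1 : ‖b (x, n, false) + (lineSlope n : ℂ) • b (x, n, true)‖ ≤ 2 := by
      refine (norm_add_le _ _).trans ?_
      rw [norm_smul, hb.1, hb.1, Complex.norm_real, Real.norm_of_nonneg hs.le]
      linarith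
    have h2 : ‖(1 + (lineSlope n : ℂ) ^ 2)‖⁻¹ ≤ 1 := by
      refine inv_le_one_of_one_le₀ ?_
      have : (1 + (lineSlope n : ℂ) ^ 2) = ((1 + lineSlope n ^ 2 : ℝ) : ℂ) := by push_cast; rfl
      rw [this, Complex.norm_real, Real.norm_of_nonneg (by positivity)]
      nlinarith
    rw [Complex.norm_real, Real.norm_of_nonneg hs.le]
    exact mul_le_mul (mul_le_of_le_one_left hs.le h2) h1 (norm_nonneg _) hs.le

end Projections

/-! ### Density of the C*-algebra generated by a set -/

theorem exists_dense_mk_eq_topDensity.{u} (X : Type u) [TopologicalSpace X] :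
    ∃ s : Set X, Dense s ∧ #s = topDensity X :=
  csInf_mem (s := {κ | ∃ s : Set X, Dense s ∧ #s = κ}) ⟨_, Set.univ, dense_univ, rfl⟩

/-- A uniformly separated family is at most as large as the density. -/
theorem mk_le_topDensity.{u} {X I : Type u} [PseudoMetricSpace X] {f : I → X} {ε : ℝ} (hε : 0 < ε)
    (hf : Pairwise fun i j => ε ≤ dist (f i) (f j)) : #I ≤ topDensity X := by
  obtain ⟨s, hs, hcard⟩ := exists_dense_mk_eq_topDensity X
  rw [← hcard]
  choose g hgs hg using fun i => Metric.dense_iff.1 hs (f i) (ε / 2) (by positivity)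
  refine mk_le_of_injective (f := fun i => (⟨g i, hg i⟩ : s)) fun i j hij => ?_
  by_contra hne
  have h1 : g i = g j := congrArg Subtype.val hij
  have h2 := hgs i
  have h3 := hgs j
  rw [Metric.mem_ball] at h2 h3
  have h4 := dist_triangle_left (f i) (f j) (g i)
  have h5 := hf hne
  rw [← h1] at h3
  linarith

open scoped Pointwise in
/-- The algebra generated by an infinite set `s` has a dense subset no larger than `s`: the finite
sums of multiples of products of elements of `s` by scalars from a countable dense set. -/
theorem exists_dense_adjoin.{u} {B : Type u} [NormedRing B] [NormedAlgebra ℂ B] {s : Set B}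
    (hs : ℵ₀ ≤ #s) : ∃ t : Set B, t ⊆ NonUnitalAlgebra.adjoin ℂ s ∧ #t ≤ #s ∧
      (NonUnitalAlgebra.adjoin ℂ s : Set B) ⊆ closure t := by
  have hcard {t : Set B} (ht : #t ≤ #s) : #(Algebra.adjoin ℤ t) ≤ #s := by
    have := Algebra.lift_cardinalMk_adjoin_le ℤ t
    simp only [mk_int, lift_aleph0, lift_id'] at this
    exact this.trans (by simp [ht, hs])
  set M := Subsemigroup.closure s with hM
  have hMs : #M ≤ #s := by
    refine le_trans (mk_le_mk_of_subset ?_) (hcard le_rfl)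
    intro x hx
    induction hx using Subsemigroup.closure_induction with
    | mem x hx => exact Algebra.subset_adjoin hx
    | mul x y _ _ hx hy => exact mul_mem hx hy
  obtain ⟨D, hDc, hD⟩ := TopologicalSpace.exists_countable_dense ℂ
  set T : Set B := Set.image2 (fun c x => c • x) D M with hT
  have hTs : #T ≤ #s := by
    have hrange : T = Set.range fun p : D × M => (p.1 : ℂ) • (p.2 : B) := by
      ext x
      simp [hT, -Set.image2_smul]
    rw [hrange]
    have h := mk_range_le_lift (f := fun p : D × M => (p.1 : ℂ) • (p.2 : B))
    rw [mk_prod, lift_mul, lift_lift, lift_lift, lift_id'] at h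
    refine h.trans ((mul_le_mul' ?_ ((lift_id _).le.trans hMs)).trans (aleph0_mul_eq hs).le)
    simpa using hDc
  set G := AddSubmonoid.closure T with hG
  have hadj : (NonUnitalAlgebra.adjoin ℂ s : Set B) = Submodule.span ℂ (M : Set B) :=
    congrArg (fun S : Submodule ℂ B => (S : Set B)) (NonUnitalAlgebra.adjoin_eq_span s)
  refine ⟨G, ?_, ?_, ?_⟩
  · rw [hadj]
    intro x hx
    induction hx using AddSubmonoid.closure_induction with
    | mem x hx =>
      obtain ⟨c, -, y, hy, rfl⟩ := hx
      exact Submodule.smul_mem _ _ (Submodule.subset_span hy)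
    | zero => exact zero_mem _
    | add x y _ _ hx hy => exact Submodule.add_mem _ hx hy
  · refine le_trans (mk_le_mk_of_subset ?_) (hcard hTs)
    intro x hx
    induction hx using AddSubmonoid.closure_induction with
    | mem x hx => exact Algebra.subset_adjoin hx
    | zero => exact zero_mem _
    | add x y _ _ hx hy => exact add_mem hx hy
  · rw [hadj]
    intro x hx
    replace hx : x ∈ AddSubmonoid.closure ((Set.univ : Set ℂ) • (M : Set B)) := by
      rw [← Submodule.span_eq_closure]
      exact hx
    change x ∈ G.topologicalClosure
    induction hx using AddSubmonoid.closure_induction with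
    | mem x hx =>
      obtain ⟨c, -, y, hy, rfl⟩ := hx
      have hc : c ∈ closure D := hD c
      exact map_mem_closure (f := fun c : ℂ => c • y) (by fun_prop) hc fun d hd =>
        AddSubmonoid.subset_closure ⟨d, hd, y, hy, rfl⟩
    | zero => exact zero_mem _
    | add x y _ _ hx hy => exact add_mem hx hy

theorem coe_starAdjoin_eq_coe_adjoin {B : Type*} [NonUnitalCStarAlgebra B] {s : Set B}
    (hs : ∀ a ∈ s, star a = a) :
    (NonUnitalStarAlgebra.adjoin ℂ s : Set B) = NonUnitalAlgebra.adjoin ℂ s := by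
  have hstar : star s = s := by
    ext a
    refine ⟨fun ha => ?_, fun ha => ?_⟩
    · rw [← star_star a, hs _ ha]
      exact ha
    · rw [Set.mem_star, hs a ha]
      exact ha
  have h := NonUnitalStarAlgebra.adjoin_toNonUnitalSubalgebra ℂ s
  rw [hstar, Set.union_self] at h
  exact congrArg (fun S : NonUnitalSubalgebra ℂ B => (S : Set B)) h

/-- A closed subspace that contains a set of self-adjoint elements and is closed under products contains the
C*-algebra generated by that set. -/
theorem topologicalClosure_adjoin_subset {B : Type*} [NonUnitalCStarAlgebra B] {s : Set B}
    (hs : ∀ a ∈ s, star a = a) {W : Submodule ℂ B} (hW : IsClosed (W : Set B)) (hsW : s ⊆ W)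
    (hmul : ∀ x ∈ W, ∀ y ∈ W, x * y ∈ W) :
    ((NonUnitalStarAlgebra.adjoin ℂ s).topologicalClosure : Set B) ⊆ W := by
  refine closure_minimal ?_ hW
  rw [coe_starAdjoin_eq_coe_adjoin hs]
  intro x hx
  induction hx using NonUnitalAlgebra.adjoin_induction with
  | mem x hx => exact hsW hx
  | add x y _ _ hx hy => exact W.add_mem hx hy
  | zero => exact W.zero_mem
  | mul x y _ _ hx hy => exact hmul x hx y hy
  | smul r x _ hx => exact W.smul_mem r hx

/-- The C*-algebra generated by an infinite set of self-adjoint elements is at most as dense as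
that set is large. -/
theorem topDensity_topologicalClosure_adjoin_le.{u} {B : Type u} [CStarAlgebra B] {s : Set B}
    (hs : ∀ a ∈ s, star a = a) (hinf : ℵ₀ ≤ #s) :
    topDensity (NonUnitalStarAlgebra.adjoin ℂ s).topologicalClosure ≤ #s := by
  obtain ⟨t, hts, htc, htd⟩ := exists_dense_adjoin hinf
  rw [← coe_starAdjoin_eq_coe_adjoin hs] at hts htd
  set A := NonUnitalStarAlgebra.adjoin ℂ s
  have htA : t ⊆ A.topologicalClosure := hts.trans A.le_topologicalClosure
  have hdense : Dense (Subtype.val ⁻¹' t : Set A.topologicalClosure) := by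
    intro x
    rw [Topology.IsInducing.subtypeVal.closure_eq_preimage_closure_image, Set.mem_preimage]
    have himage : t ⊆ Subtype.val '' (Subtype.val ⁻¹' t : Set A.topologicalClosure) := by
      intro y hy
      exact ⟨⟨y, htA hy⟩, hy, rfl⟩
    exact closure_mono himage (closure_minimal htd isClosed_closure x.2)
  exact (csInf_le' (s := {κ | ∃ s : Set A.topologicalClosure, Dense s ∧ #s = κ})
    ⟨_, hdense, rfl⟩).trans
    ((mk_preimage_of_injective _ _ Subtype.val_injective).trans htc)

/-! ### Operators that vanish along the limits of the orthonormal family -/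

section Vanishing

open Filter Topology

variable {H : Type*} [NormedAddCommGroup H] [InnerProductSpace ℂ H] {X Ω : Type*}

/-- The filter generated by the subsets of `S` with countable complement in `S`. -/
noncomputable def cocountableOn (S : Set Ω) : Filter Ω := cocountable ⊓ 𝓟 S

instance (S : Set Ω) : CountableInterFilter (cocountableOn S) := by
  have : CountableInterFilter (cocountable : Filter Ω) :=
    CardinalInterFilter.toCountableInterFilter _ aleph0_lt_aleph_one
  unfold cocountableOn
  infer_instance

theorem eventually_cocountableOn {S : Set Ω} {p : Ω → Prop} :
    (∀ᶠ ξ in cocountableOn S, p ξ) ↔ {ξ | ξ ∈ S ∧ ¬ p ξ}.Countable := by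
  rw [cocountableOn, eventually_inf_principal, Filter.Eventually, mem_cocountable]
  simp only [Set.compl_def, Set.mem_ofPred_eq, Classical.not_imp]

theorem cocountableOn_neBot {S : Set Ω} (hS : ¬ S.Countable) : (cocountableOn S).NeBot := by
  refine ⟨fun h => hS ?_⟩
  have : ∀ᶠ ξ in cocountableOn S, False := by simp [h]
  simpa using eventually_cocountableOn.1 this

variable (b : X × ℕ × Bool → H)

/-- The operators that tend to zero on the orthonormal family `b` along `F ξ`, for all but countably
many points `ξ` of `S`. -/
def vanishingOperators (F : Ω → Filter X) (S : Set Ω) : Submodule ℂ (H →L[ℂ] H) where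
  carrier := {a | ∀ᶠ ξ in cocountableOn S, ∀ n i, Tendsto (fun x => a (b (x, n, i))) (F ξ) (𝓝 0)}
  add_mem' {a c} ha hc := by
    simp only [Set.mem_ofPred_eq] at ha hc ⊢
    filter_upwards [ha, hc] with ξ h1 h2 n i
    simpa using (h1 n i).add (h2 n i)
  zero_mem' := by
    simp only [Set.mem_ofPred_eq, zero_apply]
    exact Eventually.of_forall fun _ _ _ => tendsto_const_nhds
  smul_mem' t a ha := by
    simp only [Set.mem_ofPred_eq] at ha ⊢
    filter_upwards [ha] with ξ h1 n i
    simpa using (h1 n i).const_smul t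

/-- The operators that tend to zero on the second axes of the planes spanned by `b (x, n, false)`
and `b (x, n, true)`, as `n` tends to infinity, uniformly in `x`. -/
def axisNullOperators : Submodule ℂ (H →L[ℂ] H) where
  carrier := {a | ∀ ε > 0, ∀ᶠ n in atTop, ∀ x, ‖a (b (x, n, true))‖ ≤ ε}
  add_mem' {a c} ha hc ε hε := by
    filter_upwards [ha (ε / 2) (by positivity), hc (ε / 2) (by positivity)] with n h1 h2 x
    have := norm_add_le (a (b (x, n, true))) (c (b (x, n, true)))
    simp only [add_apply]
    linarith [h1 x, h2 x]
  zero_mem' ε hε := by simp [le_of_lt hε]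
  smul_mem' t a ha ε hε := by
    filter_upwards [ha (ε / (‖t‖ + 1)) (by positivity)] with n h1 x
    rw [smul_apply, norm_smul]
    have h2 := h1 x
    rw [le_div_iff₀ (by positivity)] at h2
    nlinarith [norm_nonneg t, norm_nonneg (a (b (x, n, true)))]

variable {b} {F : Ω → Filter X} {S : Set Ω}

theorem mem_vanishingOperators {a : H →L[ℂ] H} : a ∈ vanishingOperators b F S ↔
    ∀ᶠ ξ in cocountableOn S, ∀ n i, Tendsto (fun x => a (b (x, n, i))) (F ξ) (𝓝 0) :=
  Iff.rfl

theorem norm_apply_le_add (hb : Orthonormal ℂ b) (a c : H →L[ℂ] H) (y : X × ℕ × Bool) :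
    ‖a (b y)‖ ≤ ‖a - c‖ + ‖c (b y)‖ := by
  have h1 : a (b y) = (a - c) (b y) + c (b y) := by simp
  have h2 := (a - c).le_opNorm (b y)
  rw [hb.1, mul_one] at h2
  rw [h1]
  exact (norm_add_le _ _).trans (by gcongr)

theorem isClosed_vanishingOperators (hb : Orthonormal ℂ b) :
    IsClosed (vanishingOperators b F S : Set (H →L[ℂ] H)) := by
  refine isClosed_of_closure_subset fun a ha => ?_
  obtain ⟨u, hu, hlim⟩ := mem_closure_iff_seq_limit.1 ha
  rw [SetLike.mem_coe, mem_vanishingOperators]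
  filter_upwards [eventually_countable_forall.2 hu] with ξ hξ n i
  rw [Metric.tendsto_nhds]
  intro ε hε
  obtain ⟨k, hk⟩ := ((Metric.tendsto_nhds.1 hlim) (ε / 2) (by positivity)).exists
  filter_upwards [Metric.tendsto_nhds.1 (hξ k n i) (ε / 2) (by positivity)] with x hx
  rw [dist_zero_right] at hx ⊢
  rw [dist_comm, dist_eq_norm] at hk
  linarith [norm_apply_le_add hb a (u k) (x, n, i)]

theorem isClosed_axisNullOperators (hb : Orthonormal ℂ b) :
    IsClosed (axisNullOperators b : Set (H →L[ℂ] H)) := by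
  refine isClosed_of_closure_subset fun a ha ε hε => ?_
  obtain ⟨c, hc, hac⟩ := Metric.mem_closure_iff.1 ha (ε / 2) (by positivity)
  filter_upwards [hc (ε / 2) (by positivity)] with n hn x
  rw [dist_eq_norm] at hac
  linarith [norm_apply_le_add hb a c (x, n, true), hn x]

theorem mul_mem_vanishingOperators (c : H →L[ℂ] H) {a : H →L[ℂ] H}
    (ha : a ∈ vanishingOperators b F S) : c * a ∈ vanishingOperators b F S := by
  rw [mem_vanishingOperators] at ha ⊢
  filter_upwards [ha] with ξ h1 n i
  have := (c.continuous.tendsto 0).comp (h1 n i)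
  rwa [map_zero] at this

theorem mul_mem_axisNullOperators (c : H →L[ℂ] H) {a : H →L[ℂ] H}
    (ha : a ∈ axisNullOperators b) : c * a ∈ axisNullOperators b := by
  intro ε hε
  filter_upwards [ha (ε / (‖c‖ + 1)) (by positivity)] with n h1 x
  have h2 := h1 x
  rw [le_div_iff₀ (by positivity)] at h2
  rw [mul_apply_eq_comp]
  refine (c.le_opNorm _).trans ?_
  nlinarith [norm_nonneg c, norm_nonneg (a (b (x, n, true)))]

variable [CompleteSpace H]

theorem colorProj_mem_axisNullOperators (hb : Orthonormal ℂ b) (χ : X → Option Bool) :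
    colorProj b χ ∈ axisNullOperators b := by
  intro ε hε
  filter_upwards [tendsto_lineSlope.eventually (gt_mem_nhds (half_pos hε))] with n hn x
  linarith [norm_colorProj_true_le hb χ x n]

theorem colorProj_mem_vanishingOperators {χ : Ω → Option Bool} {χ' : X → Option Bool}
    (hχ : IsColoringLift F χ χ') (hS : (S ∩ colorSupport χ).Countable) :
    colorProj b χ' ∈ vanishingOperators b F S := by
  refine eventually_cocountableOn.2 (hS.mono ?_)
  rintro ξ ⟨hξ, h⟩
  refine ⟨hξ, fun hn => h fun n i => ?_⟩
  refine tendsto_const_nhds.congr' ?_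
  filter_upwards [hχ ξ] with x hx
  rw [colorProj_of_none (hx.trans hn)]

theorem mul_colorProj_mem_vanishingOperators (hb : Orthonormal ℂ b) {χ : Ω → Option Bool}
    {χ' : X → Option Bool} (hχ : IsColoringLift F χ χ') {a : H →L[ℂ] H}
    (ha : a ∈ vanishingOperators b F S) : a * colorProj b χ' ∈ vanishingOperators b F S := by
  rw [mem_vanishingOperators] at ha ⊢
  filter_upwards [ha] with ξ h n i
  rcases hc : χ ξ with _ | _ | _
  · refine tendsto_const_nhds.congr' ?_
    filter_upwards [hχ ξ] with x hx
    simp [colorProj_of_none (hx.trans hc)]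
  · cases i
    · refine (h n false).congr' ?_
      filter_upwards [hχ ξ] with x hx
      simp [colorProj_of_false_false hb (hx.trans hc)]
    · refine tendsto_const_nhds.congr' ?_
      filter_upwards [hχ ξ] with x hx
      simp [colorProj_of_false_true (hx.trans hc)]
  · have h1 := ((h n false).add ((h n true).const_smul (lineSlope n : ℂ))).const_smul
      ((1 + (lineSlope n : ℂ) ^ 2)⁻¹ * (if i then (lineSlope n : ℂ) else 1))
    rw [smul_zero, add_zero, smul_zero] at h1
    refine h1.congr' ?_
    filter_upwards [hχ ξ] with x hx
    rw [mul_apply_eq_comp, colorProj_of_true hb (hx.trans hc), map_smul, map_add,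
      map_smul]

theorem colorProj_notMem_vanishingOperators (hb : Orthonormal ℂ b) [∀ ξ, (F ξ).NeBot]
    {χ : Ω → Option Bool} {χ' : X → Option Bool} (hχ : IsColoringLift F χ χ')
    (hunc : ¬ (colorSupport χ).Countable) :
    colorProj b χ' ∉ vanishingOperators b F (colorSupport χ) := by
  intro h
  have := cocountableOn_neBot hunc
  have hmem : ∀ᶠ ξ in cocountableOn (colorSupport χ), ξ ∈ colorSupport χ :=
    eventually_cocountableOn.2 (by simp)
  obtain ⟨ξ, hξ, hS⟩ := ((mem_vanishingOperators.1 h).and hmem).exists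
  obtain ⟨x, hx, hcol⟩ := ((Metric.tendsto_nhds.1 (hξ 0 false) (1 / 2) (by positivity)).and
    (hχ ξ)).exists
  rw [dist_zero_right] at hx
  exact absurd (half_le_norm_colorProj hb (hcol ▸ hS : χ' x ≠ none)) (not_le.2 hx)

end Vanishing

/-! ### The C*-algebra generated by the projections of a Luzin family -/

section LuzinAlgebra

open Filter Topology

variable {H : Type*} [NormedAddCommGroup H] [InnerProductSpace ℂ H] [CompleteSpace H]
  {X Ω I : Type*} {b : X × ℕ × Bool → H} {F : Ω → Filter X}

/-- If `c * a = a` for `a` close to `colorProj b χ'` along `F ξ`, then `c` almost fixes the range of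
that projection on the planes of `b` along `F ξ`. -/
theorem tendsto_mul_colorProj_sub {χ' : X → Option Bool} {a c : H →L[ℂ] H} (hca : c * a = a) {ξ : Ω}
    {y : X → X × ℕ × Bool}
    (ha : Tendsto (fun x => (a - colorProj b χ') (b (y x))) (F ξ) (𝓝 0)) :
    Tendsto (fun x => (c - 1) (colorProj b χ' (b (y x)))) (F ξ) (𝓝 0) := by
  have h1 := ((1 - c).continuous.tendsto 0).comp ha
  rw [map_zero] at h1
  refine h1.congr fun x => ?_
  have h2 : (1 - c) * (a - colorProj b χ') = (c - 1) * colorProj b χ' := by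
    have h3 : (1 - c) * (a - colorProj b χ') = a - c * a + (c - 1) * colorProj b χ' := by
      noncomm_ring
    rw [h3, hca, sub_self, zero_add]
  exact DFunLike.congr_fun h2 (b (y x))

/-- No element of `axisNullOperators b` is a left unit for both an operator that tends to the first
axes along `F ξ` and an operator that tends to the lines of slope `1 / (n + 1)`: it would tend to
the identity on the planes of `b`. -/
theorem false_of_common_upper_bound (hb : Orthonormal ℂ b) [∀ ξ, (F ξ).NeBot]
    {χ ψ : Ω → Option Bool} {χ' ψ' : X → Option Bool} (hχ : IsColoringLift F χ χ')
    (hψ : IsColoringLift F ψ ψ') {ξ : Ω} (hχξ : χ ξ = some false) (hψξ : ψ ξ = some true)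
    {a c d : H →L[ℂ] H} (hda : d * a = a) (hdc : d * c = c) (hd : d ∈ axisNullOperators b)
    (ha : ∀ n i, Tendsto (fun x => (a - colorProj b χ') (b (x, n, i))) (F ξ) (𝓝 0))
    (hc : ∀ n i, Tendsto (fun x => (c - colorProj b ψ') (b (x, n, i))) (F ξ) (𝓝 0)) : False := by
  obtain ⟨n, hn⟩ := (hd (1 / 2) (by positivity)).exists
  have h1 := tendsto_mul_colorProj_sub hda (ha n false)
  have h2 := tendsto_mul_colorProj_sub hdc (hc n false)
  have hs : (lineSlope n : ℂ) ≠ 0 := by exact_mod_cast (lineSlope_pos n).ne'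
  have hne : (1 + (lineSlope n : ℂ) ^ 2) ≠ 0 := by
    have : (0 : ℝ) < 1 + lineSlope n ^ 2 := by positivity
    exact_mod_cast this.ne'
  -- The second axis is spanned by the first axis and the line of slope `1 / (n + 1)`.
  have h3 : Tendsto (fun x => (d - 1) (b (x, n, true))) (F ξ) (𝓝 0) := by
    have h4 := ((h2.const_smul (1 + (lineSlope n : ℂ) ^ 2)).sub h1).const_smul (lineSlope n : ℂ)⁻¹
    rw [smul_zero, sub_zero, smul_zero] at h4
    refine h4.congr' ?_
    filter_upwards [hχ ξ, hψ ξ] with x hx hx'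
    rw [colorProj_of_false_false hb (hx.trans hχξ), colorProj_of_true hb (hx'.trans hψξ),
      if_neg (by simp), mul_one, ← map_smul, smul_inv_smul₀ hne, ← map_sub, add_sub_cancel_left,
      ← map_smul, inv_smul_smul₀ hs]
  obtain ⟨x, hx⟩ := (Metric.tendsto_nhds.1 h3 (1 / 2) (by positivity)).exists
  rw [dist_zero_right, sub_apply, one_apply_eq_self] at hx
  have h5 := norm_sub_norm_le (b (x, n, true)) (d (b (x, n, true)))
  rw [hb.1, norm_sub_rev] at h5
  linarith [hn x]

/-- If `j + t p` is an approximate right unit for `p`, where `p` is the projection of the colouring `χ`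
and `j` vanishes along the support of `χ`, then `t ≠ 0`. -/
theorem coeff_ne_zero_of_norm_lt (hb : Orthonormal ℂ b) [∀ ξ, (F ξ).NeBot]
    {χ : Ω → Option Bool} {χ' : X → Option Bool} (hχ : IsColoringLift F χ χ')
    (hunc : ¬ (colorSupport χ).Countable) {j : H →L[ℂ] H} {t : ℂ}
    (hj : j ∈ vanishingOperators b F (colorSupport χ))
    (hlt : ‖colorProj b χ' - colorProj b χ' * (j + t • colorProj b χ')‖ < 1 / 4) : t ≠ 0 := by
  rintro rfl
  rw [zero_smul, add_zero] at hlt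
  have := cocountableOn_neBot hunc
  have hmem : ∀ᶠ ξ in cocountableOn (colorSupport χ), ξ ∈ colorSupport χ :=
    eventually_cocountableOn.2 (by simp)
  obtain ⟨ξ, hξ, hS⟩ := ((mem_vanishingOperators.1
    (mul_mem_vanishingOperators (colorProj b χ') hj)).and hmem).exists
  obtain ⟨x, hx, hcol⟩ := ((Metric.tendsto_nhds.1 (hξ 0 false) (1 / 4) (by positivity)).and
    (hχ ξ)).exists
  rw [dist_zero_right] at hx
  have h1 := half_le_norm_colorProj hb (hcol ▸ hS : χ' x ≠ none)
  linarith [norm_apply_le_add hb (colorProj b χ') (colorProj b χ' * j) (x, 0, false)]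

/-- Modulo vanishing operators, coefficients of `p` are multiplicative, so that `u = u v` forces the
coefficient of `v` to be `1` if that of `u` is not zero. -/
theorem coeff_eq_one_of_eq_mul (hb : Orthonormal ℂ b) [∀ ξ, (F ξ).NeBot]
    {χ : Ω → Option Bool} {χ' : X → Option Bool} (hχ : IsColoringLift F χ χ')
    (hunc : ¬ (colorSupport χ).Countable) {j k : H →L[ℂ] H} {t s : ℂ} (ht : t ≠ 0)
    (hj : j ∈ vanishingOperators b F (colorSupport χ))
    (hk : k ∈ vanishingOperators b F (colorSupport χ))
    (huv : j + t • colorProj b χ' = (j + t • colorProj b χ') * (k + s • colorProj b χ')) :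
    s = 1 := by
  set p := colorProj b χ' with hp
  by_contra hs
  have hne : t * (1 - s) ≠ 0 := mul_ne_zero ht (sub_ne_zero.2 (Ne.symm hs))
  refine colorProj_notMem_vanishingOperators hb hχ hunc ?_
  rw [← Submodule.smul_mem_iff _ hne, ← hp]
  have h1 : (t * (1 - s)) • p = j * k + s • (j * p) + t • (p * k) - j := by
    have h2 : (j + t • p) * (k + s • p) = j * k + s • (j * p) + t • (p * k) + (t * s) • p := by
      rw [add_mul, mul_add, mul_add, mul_smul_comm, smul_mul_assoc, smul_mul_smul_comm,
        colorProj_mul_self]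
      abel
    rw [h2] at huv
    rw [mul_sub, mul_one, sub_smul, sub_eq_iff_eq_add, ← sub_eq_iff_eq_add'.2 huv]
    abel
  rw [h1]
  exact Submodule.sub_mem _ (Submodule.add_mem _ (Submodule.add_mem _
    (mul_mem_vanishingOperators _ hk)
    (Submodule.smul_mem _ _ (mul_colorProj_mem_vanishingOperators hb hχ hj)))
    (Submodule.smul_mem _ _ (mul_mem_vanishingOperators _ hk))) hj

/-- A C*-algebra of operators that contains the projections of a Luzin family, and in which these
projections are atoms up to vanishing operators, is not `≪`-unital. -/
theorem not_isWayBelowUnital_of_isLuzinFamily (hb : Orthonormal ℂ b) [∀ ξ, (F ξ).NeBot]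
    {χ : I → Ω → Option Bool} {χ' : I → X → Option Bool}
    (hχ : IsLuzinFamily χ) (hlift : ∀ i, IsColoringLift F (χ i) (χ' i))
    (A : NonUnitalStarSubalgebra ℂ (H →L[ℂ] H)) [IsClosed (A : Set (H →L[ℂ] H))]
    (hmem : ∀ i, colorProj b (χ' i) ∈ A) (hnull : ∀ a ∈ A, a ∈ axisNullOperators b)
    (hatom : ∀ i, ∀ a ∈ A, a ∈ vanishingOperators b F (colorSupport (χ i)) ⊔
      Submodule.span ℂ {colorProj b (χ' i)}) : ¬ IsWayBelowUnital A := by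
  rintro ⟨Λ, r, u, hu, hinc⟩
  have hstar (l : Λ) : star (u l : H →L[ℂ] H) = u l := by
    obtain ⟨a, ha⟩ := hu.pos l
    have h : star (u l) = u l := by rw [ha, star_mul, star_star]
    exact congrArg Subtype.val h
  have hmul {l m : Λ} (h : r l m) : (u l : H →L[ℂ] H) = u l * u m :=
    congrArg Subtype.val (hinc l m h)
  have hmul' {l m : Λ} (h : r l m) : (u m : H →L[ℂ] H) * u l = u l := by
    have := congrArg star (hmul h)
    rw [star_mul, hstar, hstar] at this
    exact this.symm
  have hexists (i : I) : ∃ l, (u l : H →L[ℂ] H) - colorProj b (χ' i) ∈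
      vanishingOperators b F (colorSupport (χ i)) := by
    obtain ⟨l₀, hl₀⟩ := hu.tendsto ⟨_, hmem i⟩ (1 / 4) (by positivity)
    obtain ⟨l, hl, -⟩ := hu.index.directed l₀ l₀
    obtain ⟨m, hm, -⟩ := hu.index.directed l l
    have hlt : ‖colorProj b (χ' i) - colorProj b (χ' i) * (u l : H →L[ℂ] H)‖ < 1 / 4 := hl₀ l hl
    obtain ⟨j, hj, q, hq, hjq⟩ := Submodule.mem_sup.1 (hatom i _ (u l).2)
    obtain ⟨t, rfl⟩ := Submodule.mem_span_singleton.1 hq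
    obtain ⟨k, hk, q', hq', hkq⟩ := Submodule.mem_sup.1 (hatom i _ (u m).2)
    obtain ⟨s, rfl⟩ := Submodule.mem_span_singleton.1 hq'
    rw [← hjq] at hlt
    have ht := coeff_ne_zero_of_norm_lt hb (hlift i) (hχ.uncountable i) hj hlt
    have huv := hmul hm
    rw [← hjq, ← hkq] at huv
    have hs := coeff_eq_one_of_eq_mul hb (hlift i) (hχ.uncountable i) ht hj hk huv
    refine ⟨m, ?_⟩
    rw [← hkq, hs, one_smul, add_sub_cancel_right]
    exact hk
  choose l hl using hexists
  obtain ⟨i, j, ξ, hξ, c, hic, hjc⟩ := hχ.conflict _ fun i => eventually_cocountableOn.1 (hl i)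
  have hi : ∀ n k, Tendsto (fun x => ((u (l i) : H →L[ℂ] H) - colorProj b (χ' i)) (b (x, n, k)))
      (F ξ) (𝓝 0) := by
    by_contra h
    exact hξ (Or.inl ⟨by simp [colorSupport, hic], h⟩)
  have hj : ∀ n k, Tendsto (fun x => ((u (l j) : H →L[ℂ] H) - colorProj b (χ' j)) (b (x, n, k)))
      (F ξ) (𝓝 0) := by
    by_contra h
    exact hξ (Or.inr ⟨by simp [colorSupport, hjc], h⟩)
  obtain ⟨m, him, hjm⟩ := hu.index.directed (l i) (l j)
  cases c
  · exact false_of_common_upper_bound hb (hlift i) (hlift j) hic hjc (hmul' him) (hmul' hjm)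
      (hnull _ (u m).2) hi hj
  · exact false_of_common_upper_bound hb (hlift j) (hlift i) hjc hic (hmul' hjm) (hmul' him)
      (hnull _ (u m).2) hj hi

end LuzinAlgebra

/-- A Luzin family of `ℵ₂` many partial two-colourings of `Ω` that lift to the index set `X` of an
orthonormal family gives a C*-algebra of density `ℵ₂` which is not `≪`-unital. -/
theorem hasNonWayBelowUnitalSubalgebra_of_lift.{u, v} {H : Type u} [NormedAddCommGroup H]
    [InnerProductSpace ℂ H] [CompleteSpace H] {X : Type v} {Ω : Type u} {b : X × ℕ × Bool → H}
    (hb : Orthonormal ℂ b) {F : Ω → Filter X} [∀ ξ, (F ξ).NeBot] (hF : LiftsColorings F)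
    (hΩ : #Ω = ℵ₁) : HasNonWayBelowUnitalSubalgebra H (ℵ_ 2) := by
  obtain ⟨I, hI⟩ : ∃ I : Type u, #I = ℵ_ 2 := ⟨_, mk_out _⟩
  obtain ⟨χ, hχ⟩ := exists_isLuzinFamily hΩ hI
  choose lift hlift using hF
  set p : I → H →L[ℂ] H := fun i => colorProj b (lift (χ i)) with hp
  have hsep : Pairwise fun i j => 1 / 2 ≤ dist (p i) (p j) := by
    intro i j hij
    obtain ⟨ξ, hi, hj⟩ : ∃ ξ, χ i ξ ≠ none ∧ χ j ξ = none := by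
      by_contra! h
      refine hχ.uncountable i ((hχ.almostDisjoint hij).mono fun ξ hξ => ?_)
      exact ⟨hξ, h ξ hξ⟩
    obtain ⟨x, hxi, hxj⟩ := ((hlift (χ i) ξ).and (hlift (χ j) ξ)).exists
    have h1 := half_le_norm_colorProj hb (hxi ▸ hi : lift (χ i) x ≠ none)
    have h2 := norm_apply_le_add hb (p i) (p j) (x, 0, false)
    rw [hp, colorProj_of_none (hxj.trans hj), norm_zero, add_zero] at h2
    rw [dist_eq_norm]
    exact h1.trans h2
  have hpinj : p.Injective := by
    intro i j hij
    by_contra hne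
    have := hsep hne
    simp only [hij, dist_self] at this
    linarith
  have hcard : #(Set.range p) = ℵ_ 2 := by rw [mk_range_eq p hpinj, hI]
  have hstar : ∀ a ∈ Set.range p, star a = a := by
    rintro _ ⟨i, rfl⟩
    exact star_colorProj b _
  set A := (NonUnitalStarAlgebra.adjoin ℂ (Set.range p)).topologicalClosure with hA
  have hclosed : IsClosed (A : Set (H →L[ℂ] H)) :=
    NonUnitalStarSubalgebra.isClosed_topologicalClosure _
  have hmem (i : I) : p i ∈ A := NonUnitalStarSubalgebra.le_topologicalClosure _
    (NonUnitalStarAlgebra.subset_adjoin ℂ _ ⟨i, rfl⟩)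
  refine ⟨A, hclosed, le_antisymm ?_ ?_, ?_⟩
  · rw [← hcard]
    exact topDensity_topologicalClosure_adjoin_le hstar (hcard ▸ aleph0_le_aleph 2)
  · rw [← hI]
    exact mk_le_topDensity (f := fun i => (⟨p i, hmem i⟩ : A)) (by norm_num : (0 : ℝ) < 1 / 2) hsep
  refine not_isWayBelowUnital_of_isLuzinFamily hb hχ (fun i => hlift (χ i)) A hmem ?_ ?_
  · refine topologicalClosure_adjoin_subset hstar (isClosed_axisNullOperators hb) ?_
      fun a _ c hc => mul_mem_axisNullOperators a hc
    rintro _ ⟨i, rfl⟩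
    exact colorProj_mem_axisNullOperators hb _
  · intro i
    refine topologicalClosure_adjoin_subset hstar
      (Submodule.isClosed_sup_finiteDimensional _ _ (isClosed_vanishingOperators hb)) ?_ ?_
    · rintro _ ⟨j, rfl⟩
      by_cases hij : i = j
      · subst hij
        exact Submodule.mem_sup_right (Submodule.mem_span_singleton_self _)
      · exact Submodule.mem_sup_left
          (colorProj_mem_vanishingOperators (hlift (χ j)) (hχ.almostDisjoint hij))
    · intro a ha c hc
      obtain ⟨j, hj, q, hq, rfl⟩ := Submodule.mem_sup.1 ha
      obtain ⟨t, rfl⟩ := Submodule.mem_span_singleton.1 hq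
      obtain ⟨k, hk, q', hq', rfl⟩ := Submodule.mem_sup.1 hc
      obtain ⟨s, rfl⟩ := Submodule.mem_span_singleton.1 hq'
      rw [mul_add]
      refine Submodule.add_mem _
        (Submodule.mem_sup_left (mul_mem_vanishingOperators _ hk)) ?_
      rw [mul_smul_comm, add_mul, smul_mul_assoc, colorProj_mul_self]
      refine Submodule.smul_mem _ _ (Submodule.add_mem _ (Submodule.mem_sup_left
        (mul_colorProj_mem_vanishingOperators hb (hlift (χ i)) hj)) ?_)
      exact Submodule.smul_mem _ _
        (Submodule.mem_sup_right (Submodule.mem_span_singleton_self _))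

theorem exists_orthonormal_ellTwo.{u, v} {ι : Type u} {J : Type v} (e : J ↪ ι) :
    ∃ b : J → EllTwo ι, Orthonormal ℂ b := by
  let B : HilbertBasis ι ℂ (EllTwo ι) := ⟨LinearIsometryEquiv.refl ℂ _⟩
  exact ⟨B ∘ e, B.orthonormal.comp e e.injective⟩

/-- Part 1 is stated for every index set `ι` of cardinality `ℵ₁`, in any universe; part 2 is about
`ℓ₂ = ℓ₂(ℕ)`. -/
theorem theorem1p4 :
    (∀ ι : Type*, #ι = ℵ_ 1 → HasNonWayBelowUnitalSubalgebra (EllTwo ι) (ℵ_ 2)) ∧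
    ((∃ Y : Set ℝ, IsQSet Y ∧ ¬ Y.Countable) →
      HasNonWayBelowUnitalSubalgebra (EllTwo ℕ) (ℵ_ 2)) := by
  refine ⟨fun ι hι => ?_, ?_⟩
  -- Colourings of `ι` are their own lifts along principal filters.
  · obtain ⟨e⟩ : Nonempty (ι × ℕ × Bool ≃ ι) := Cardinal.eq.1 (by simp [hι])
    obtain ⟨b, hb⟩ := exists_orthonormal_ellTwo e.toEmbedding
    exact hasNonWayBelowUnitalSubalgebra_of_lift hb (F := fun ξ : ι => pure ξ)
      (fun χ => ⟨χ, fun ξ => by simp⟩) hι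
  · rintro ⟨Y, hY, hunc⟩
    obtain ⟨Y', hYY', hcard⟩ := le_mk_iff_exists_subset.1
      (aleph_one_le_iff.2 (not_le.1 fun h => hunc (le_aleph0_iff_set_countable.1 h)))
    obtain ⟨e⟩ : Nonempty ((ℕ × ℤ) × ℕ × Bool ↪ ℕ) := nonempty_embedding_nat _
    obtain ⟨b, hb⟩ := exists_orthonormal_ellTwo e
    exact hasNonWayBelowUnitalSubalgebra_of_lift hb (hY.mono hYY').liftsColorings hcard
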